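/- Let $n\in\mathbb N$, let $\theta\in M_n(\mathbb R)$ be skew-symmetric, and put $\omega_{ij}=e^{2\pi i\theta_{ij}}$. Let $C(\mathbb T_\theta^n)$ be the noncommutative $n$-torus, i.e. the universal unital C*-algebra generated by unitaries $x_1,\dots,x_n$ with $x_ix_j=\omega_{ij}x_jx_i$ for all $i,j$. For $p,q\ge 0$ let $$V_{p,q}=\mathrm{span}\{x_{i_1}\cdots x_{i_p}x_{j_q}^*\cdots x_{j_1}^*:\ i_k\ne j_l \text{ for all } k,l\}\subset C(\mathbb T_\theta^n),$$ so that $V_{0,0}=\mathbb C 1$. Let $\mathbb G=(A,\Delta)$ be a compact quantum group: $A$ is a unital C*-algebra and $\Delta:A\to A\otimes A$ (minimal tensor product) is a unital $*$-homomorphism with $(\Delta\otimes\mathrm{id})\Delta=(\mathrm{id}\otimes\Delta)\Delta$ such that the linear spans of $\Delta(A)(1\otimes A)$ and $\Delta(A)(A\otimes 1)$ are dense in $A\otimes A$. Let $\alpha:C(\mathbb T_\theta^n)\to C(\mathbb T_\theta^n)\otimes A$ be a coaction of $\mathbb G$, i.e. a unital $*$-homomorphism with $(\alpha\otimes\mathrm{id})\alpha=(\mathrm{id}\otimes\Delta)\alpha$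 such that the linear span of $\alpha(C(\mathbb T_\theta^n))(1\otimes A)$ is dense. Assume that $\alpha$ preserves the filtration: $\alpha(V_{p,q})\subset V_{p,q}\otimes A$ (algebraic tensor product) for all $p,q\ge 0$. Then there are unique elements $u_{ik}\in A$ ($1\le i,k\le n$) with $\alpha(x_k)=\sum_{i=1}^n x_i\otimes u_{ik}$ for all $k$, and they satisfy, for all $i,j,k,l\in\{1,\dots,n\}$: $$u_{ik}u_{jl}+\omega_{ji}u_{jk}u_{il}=\omega_{kl}u_{il}u_{jk}+\omega_{ji}\omega_{kl}u_{jl}u_{ik},$$ $$\sum_{i=1}^n u_{ik}u_{il}^*=\delta_{kl}1,\qquad \sum_{i=1}^n u_{il}^*u_{ik}=\delta_{kl}1,$$ $$u_{jk}u_{ik}^*=0\quad\text{and}\quad u_{ik}^*u_{jk}=0\qquad\text{for } i\ne j.$$ -/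

import Mathlib

open scoped TensorProduct

universe u v

noncomputable section

/-! ## C*-seminorms and completions of unital *-algebras -/

/-- A C*-seminorm on a unital complex *-algebra. -/
structure CStarSeminorm (F : Type u) [Ring F] [StarRing F] [Algebra ℂ F] extends
    Seminorm ℂ F where
  mul_le' : ∀ a b : F, toFun (a * b) ≤ toFun a * toFun b
  star_mul_self' : ∀ a : F, toFun (star a * a) = toFun a ^ 2

namespace CStarSeminorm

section Basic

variable {F : Type u} [Ring F] [StarRing F] [Algebra ℂ F]

instance : FunLike (CStarSeminorm F) F ℝ where
  coe p := p.toFun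
  coe_injective p q h := by
    cases p with | mk p _ _ => cases q with | mk q _ _ =>
    congr
    exact DFunLike.coe_injective h

variable (p : CStarSeminorm F)

theorem nonneg (a : F) : 0 ≤ p a := apply_nonneg p.toSeminorm a
theorem zero : p 0 = 0 := map_zero p.toSeminorm
theorem add_le (a b : F) : p (a + b) ≤ p a + p b := map_add_le_add p.toSeminorm a b
theorem neg (a : F) : p (-a) = p a := map_neg_eq_map p.toSeminorm a
theorem smul (c : ℂ) (a : F) : p (c • a) = ‖c‖ * p a := map_smul_eq_mul p.toSeminorm c a
theorem mul_le (a b : F) : p (a * b) ≤ p a * p b := p.mul_le' a b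
theorem star_mul_self (a : F) : p (star a * a) = p a ^ 2 := p.star_mul_self' a

theorem le_star (a : F) : p a ≤ p (star a) := by
  have h := p.star_mul_self a
  have h2 := p.mul_le (star a) a
  by_contra hc
  push Not at hc
  have h0 := p.nonneg (star a)
  nlinarith

theorem star_eq (a : F) : p (star a) = p a :=
  le_antisymm (by simpa using p.le_star (star a)) (p.le_star a)

/-- The pointwise supremum of a pointwise bounded family of C*-seminorms. -/
def iSup {ι : Type v} (p : ι → CStarSeminorm F)
    (hb : ∀ a, BddAbove (Set.range fun i => p i a)) : CStarSeminorm F where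
  toFun a := ⨆ i, p i a
  map_zero' := by simp [zero]
  add_le' a b := Real.iSup_le
    (fun i => ((p i).add_le a b).trans (add_le_add (le_ciSup (hb a) i) (le_ciSup (hb b) i)))
    (add_nonneg (Real.iSup_nonneg fun i => (p i).nonneg a)
      (Real.iSup_nonneg fun i => (p i).nonneg b))
  neg' a := by simp [neg]
  smul' c a := by
    simp only [smul]
    rw [Real.mul_iSup_of_nonneg (norm_nonneg c)]
  mul_le' a b := Real.iSup_le
    (fun i => ((p i).mul_le a b).trans (mul_le_mul (le_ciSup (hb a) i) (le_ciSup (hb b) i)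
      ((p i).nonneg b) (Real.iSup_nonneg fun i => (p i).nonneg a)))
    (mul_nonneg (Real.iSup_nonneg fun i => (p i).nonneg a)
      (Real.iSup_nonneg fun i => (p i).nonneg b))
  star_mul_self' a := by
    have h0 : 0 ≤ ⨆ i, p i a := Real.iSup_nonneg fun i => (p i).nonneg a
    have hs : 0 ≤ ⨆ i, p i (star a * a) := Real.iSup_nonneg fun i => (p i).nonneg _
    apply le_antisymm
    · refine Real.iSup_le (fun i => ?_) (sq_nonneg _)
      rw [star_mul_self]
      exact pow_le_pow_left₀ ((p i).nonneg a) (le_ciSup (hb a) i) 2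
    · rw [← Real.le_sqrt h0 hs]
      refine Real.iSup_le (fun i => ?_) (Real.sqrt_nonneg _)
      apply Real.le_sqrt_of_sq_le
      rw [← star_mul_self]
      exact le_ciSup (hb (star a * a)) i

theorem le_iSup {ι : Type v} (p : ι → CStarSeminorm F)
    (hb : ∀ a, BddAbove (Set.range fun i => p i a)) (i : ι) (a : F) :
    p i a ≤ CStarSeminorm.iSup p hb a := le_ciSup (hb a) i

/-- The C*-seminorm `a ↦ ‖f a‖` of a *-homomorphism into a C*-algebra. -/
def ofStarAlgHom {C : Type v} [CStarAlgebra C] (f : F →⋆ₐ[ℂ] C) : CStarSeminorm F where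
  toFun a := ‖f a‖
  map_zero' := by rw [map_zero, norm_zero]
  add_le' a b := by rw [map_add]; exact norm_add_le _ _
  neg' a := by rw [map_neg, norm_neg]
  smul' c a := by rw [map_smul, norm_smul]
  mul_le' a b := by rw [map_mul]; exact norm_mul_le _ _
  star_mul_self' a := by rw [map_mul, map_star, CStarRing.norm_star_mul_self, sq]

/-- The *-algebra `F`, seminormed by `p`. -/
@[nolint unusedArguments]
def Pre (_p : CStarSeminorm F) : Type u := F

instance : Ring p.Pre := inferInstanceAs (Ring F)
instance : StarRing p.Pre := inferInstanceAs (StarRing F)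
instance : Algebra ℂ p.Pre := inferInstanceAs (Algebra ℂ F)
instance [StarModule ℂ F] : StarModule ℂ p.Pre := inferInstanceAs (StarModule ℂ F)

/-- The underlying ring seminorm. -/
def toRingSeminorm : RingSeminorm p.Pre where
  toFun a := p a
  map_zero' := p.zero
  add_le' := p.add_le
  neg' := p.neg
  mul_le' := p.mul_le

instance : SeminormedRing p.Pre := p.toRingSeminorm.toSeminormedRing

theorem norm_def (a : p.Pre) : ‖a‖ = p a := rfl

instance : NormedAlgebra ℂ p.Pre where
  norm_smul_le c a := (p.smul c a).le

instance : NormedStarGroup p.Pre where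
  norm_star_le a := (p.star_eq a).le

/-- The Hausdorff completion of a unital *-algebra with respect to a C*-seminorm. -/
def Completion : Type u := UniformSpace.Completion p.Pre

instance : NormedRing p.Completion := inferInstanceAs (NormedRing (UniformSpace.Completion p.Pre))
instance : CompleteSpace p.Completion :=
  inferInstanceAs (CompleteSpace (UniformSpace.Completion p.Pre))
instance : Algebra ℂ p.Completion := inferInstanceAs (Algebra ℂ (UniformSpace.Completion p.Pre))

/-- The canonical map of the *-algebra into its completion. -/
def toCompletion (a : F) : p.Completion := UniformSpace.Completion.coe' (α := p.Pre) a

theorem norm_toCompletion (a : F) : ‖p.toCompletion a‖ = p a :=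
  UniformSpace.Completion.norm_coe (E := p.Pre) a

theorem denseRange_toCompletion : DenseRange p.toCompletion :=
  UniformSpace.Completion.denseRange_coe (α := p.Pre)

theorem toCompletion_mul (a b : F) :
    p.toCompletion (a * b) = p.toCompletion a * p.toCompletion b :=
  UniformSpace.Completion.coe_mul (α := p.Pre) a b

theorem toCompletion_add (a b : F) :
    p.toCompletion (a + b) = p.toCompletion a + p.toCompletion b :=
  UniformSpace.Completion.coe_add (α := p.Pre) a b

theorem toCompletion_smul (c : ℂ) (a : F) :
    p.toCompletion (c • a) = c • p.toCompletion a :=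
  UniformSpace.Completion.coe_smul (X := p.Pre) c a

theorem toCompletion_one : p.toCompletion 1 = 1 := rfl

theorem toCompletion_zero : p.toCompletion 0 = 0 := rfl

theorem uniformContinuous_star : UniformContinuous (star : p.Pre → p.Pre) :=
  (starNormedAddGroupHom (E := p.Pre)).uniformContinuous

instance : Star p.Completion where
  star := UniformSpace.Completion.map (star : p.Pre → p.Pre)

theorem star_toCompletion (a : F) : star (p.toCompletion a) = p.toCompletion (star a) :=
  UniformSpace.Completion.map_coe p.uniformContinuous_star (a : p.Pre)

instance : ContinuousStar p.Completion where
  continuous_star := UniformSpace.Completion.continuous_map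

instance : NormedAlgebra ℂ p.Completion where
  norm_smul_le c a := norm_smul_le (β := UniformSpace.Completion p.Pre) c a

@[elab_as_elim]
theorem induction_on {P : p.Completion → Prop} (a : p.Completion)
    (hc : IsClosed {a | P a}) (h : ∀ a : F, P (p.toCompletion a)) : P a :=
  p.denseRange_toCompletion.induction_on a hc h

@[elab_as_elim]
theorem induction_on₂ {P : p.Completion → p.Completion → Prop} (a b : p.Completion)
    (hc : IsClosed {x : p.Completion × p.Completion | P x.1 x.2})
    (h : ∀ a b : F, P (p.toCompletion a) (p.toCompletion b)) : P a b :=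
  p.denseRange_toCompletion.induction_on₂ hc h a b

instance : StarRing p.Completion where
  star_involutive a := by
    refine p.induction_on a ?_ ?_
    · exact isClosed_eq (by fun_prop) continuous_id
    intro a
    simp only [star_toCompletion, star_star]
  star_mul a b := by
    refine p.induction_on₂ a b ?_ ?_
    · exact isClosed_eq (by fun_prop) (by fun_prop)
    intro a b
    simp only [star_toCompletion, ← toCompletion_mul, star_mul]
  star_add a b := by
    refine p.induction_on₂ a b ?_ ?_
    · exact isClosed_eq (by fun_prop) (by fun_prop)
    intro a b
    simp only [star_toCompletion, ← toCompletion_add, star_add]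

instance : CStarRing p.Completion where
  norm_mul_self_le a := by
    refine p.induction_on a ?_ ?_
    · exact isClosed_le (by fun_prop) (by fun_prop)
    intro a
    rw [star_toCompletion, ← toCompletion_mul, norm_toCompletion, norm_toCompletion,
      star_mul_self, sq]

theorem star_smul_completion [StarModule ℂ F] (c : ℂ) (a : p.Completion) :
    star (c • a) = star c • star a := by
  refine p.induction_on a ?_ ?_
  · exact isClosed_eq (continuous_star.comp (continuous_const_smul c))
      ((continuous_const_smul (star c)).comp continuous_star)
  · intro a
    rw [← toCompletion_smul, star_toCompletion, star_toCompletion, star_smul, toCompletion_smul]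

instance [StarModule ℂ F] : StarModule ℂ p.Completion where
  star_smul := p.star_smul_completion

/-- The completion of a unital *-algebra with respect to a C*-seminorm is a C*-algebra. -/
instance [StarModule ℂ F] : CStarAlgebra p.Completion where

/-- The canonical *-homomorphism of the *-algebra into its completion. -/
def ofHom : F →⋆ₐ[ℂ] p.Completion where
  toFun := p.toCompletion
  map_one' := p.toCompletion_one
  map_mul' := p.toCompletion_mul
  map_zero' := p.toCompletion_zero
  map_add' := p.toCompletion_add
  commutes' c := by
    rw [Algebra.algebraMap_eq_smul_one, toCompletion_smul, toCompletion_one,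
      Algebra.algebraMap_eq_smul_one]
  map_star' a := (p.star_toCompletion a).symm

end Basic

section Lift

variable {F : Type u} [Ring F] [StarRing F] [Algebra ℂ F] (p : CStarSeminorm F)
  {C : Type v} [CStarAlgebra C] (f : F →⋆ₐ[ℂ] C) (hf : ∀ a, ‖f a‖ ≤ p a)

/-- The continuous linear map underlying `lift`. -/
def liftCLM : p.Completion →L[ℂ] C :=
  ContinuousLinearMap.fromCompletion (α := p.Pre)
    (LinearMap.mkContinuous (E := p.Pre) (f : F →ₗ[ℂ] C) 1 fun a => by
      rw [one_mul]; exact hf a)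

theorem liftCLM_toCompletion (a : F) : p.liftCLM f hf (p.toCompletion a) = f a :=
  ContinuousLinearMap.fromCompletion_apply_coe _ _

/-- A *-homomorphism into a C*-algebra that is dominated by `p` extends to the completion. -/
def lift : p.Completion →⋆ₐ[ℂ] C where
  toFun := p.liftCLM f hf
  map_one' := by rw [← toCompletion_one, liftCLM_toCompletion, map_one]
  map_mul' a b := by
    refine p.induction_on₂ a b ?_ ?_
    · exact isClosed_eq (by fun_prop) (by fun_prop)
    intro a b
    simp only [← toCompletion_mul, liftCLM_toCompletion, map_mul]
  map_zero' := map_zero _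
  map_add' := map_add _
  commutes' c := by
    rw [Algebra.algebraMap_eq_smul_one, map_smul, ← toCompletion_one, liftCLM_toCompletion,
      map_one, Algebra.algebraMap_eq_smul_one]
  map_star' a := by
    refine p.induction_on a ?_ ?_
    · exact isClosed_eq (by fun_prop) (by fun_prop)
    intro a
    simp only [star_toCompletion, liftCLM_toCompletion, map_star]

theorem lift_ofHom (a : F) : p.lift f hf (p.ofHom a) = f a := p.liftCLM_toCompletion f hf a

end Lift

end CStarSeminorm

/-! ## The noncommutative torus -/

/-- The unital *-algebra generated by a family of unitaries indexed by `X`, without further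
relations: the group algebra of the free group on `X`, where every group element is unitary. -/
def FreeUnitaryAlgebra (X : Type u) : Type u := MonoidAlgebra ℂ (FreeGroup X)

namespace FreeUnitaryAlgebra

variable {X : Type u}

instance : Ring (FreeUnitaryAlgebra X) := inferInstanceAs (Ring (MonoidAlgebra ℂ (FreeGroup X)))
instance : Algebra ℂ (FreeUnitaryAlgebra X) :=
  inferInstanceAs (Algebra ℂ (MonoidAlgebra ℂ (FreeGroup X)))

/-- The element `c • g`. -/
def single (g : FreeGroup X) (c : ℂ) : FreeUnitaryAlgebra X := MonoidAlgebra.single g c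

/-- The generating unitary with index `i`. -/
def gen (i : X) : FreeUnitaryAlgebra X := single (FreeGroup.of i) 1

theorem single_mul (g h : FreeGroup X) (c d : ℂ) :
    single g c * single h d = single (g * h) (c * d) := MonoidAlgebra.single_mul_single ..

theorem one_def : (1 : FreeUnitaryAlgebra X) = single 1 1 := rfl

theorem smul_single (c d : ℂ) (g : FreeGroup X) : c • single g d = single g (c * d) :=
  MonoidAlgebra.smul_single ..

theorem single_add (g : FreeGroup X) (c d : ℂ) : single g (c + d) = single g c + single g d :=
  MonoidAlgebra.single_add ..

theorem single_zero (g : FreeGroup X) : single g 0 = 0 := MonoidAlgebra.single_zero ..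

@[elab_as_elim]
theorem induction {P : FreeUnitaryAlgebra X → Prop} (a : FreeUnitaryAlgebra X)
    (h0 : P 0) (hs : ∀ g c, P (single g c)) (ha : ∀ a b, P a → P b → P (a + b)) : P a := by
  have key : ∀ f : FreeGroup X →₀ ℂ, P (MonoidAlgebra.ofCoeff f) := by
    intro f
    induction f using Finsupp.induction_linear with
    | zero => exact h0
    | add f g hf hg => exact ha _ _ hf hg
    | single g c => exact hs g c
  exact key (MonoidAlgebra.coeff a)

/-- The conjugate-linear involution with `star (c • g) = conj c • g⁻¹`. -/
def starHom : FreeUnitaryAlgebra X →+ FreeUnitaryAlgebra X :=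
  (Finsupp.liftAddHom fun g : FreeGroup X =>
    ({ toFun := fun c => single g⁻¹ (star c)
       map_zero' := by rw [star_zero, single_zero]
       map_add' := fun c d => by rw [star_add, single_add] } : ℂ →+ FreeUnitaryAlgebra X)).comp
  (MonoidAlgebra.coeffAddEquiv : MonoidAlgebra ℂ (FreeGroup X) ≃+ _).toAddMonoidHom

theorem starHom_single (g : FreeGroup X) (c : ℂ) :
    starHom (single g c) = single g⁻¹ (star c) :=
  Finsupp.liftAddHom_apply_single _ _ _

instance : StarRing (FreeUnitaryAlgebra X) where
  star := starHom
  star_involutive a := by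
    induction a using induction with
    | h0 => simp
    | hs g c => simp [starHom_single]
    | ha a b ha hb => simp [ha, hb]
  star_mul a b := by
    change starHom (a * b) = starHom b * starHom a
    induction a using induction with
    | h0 => simp
    | ha a b ha hb => simp [add_mul, mul_add, ha, hb]
    | hs g c =>
      induction b using induction with
      | h0 => simp
      | ha a b ha hb => simp [add_mul, mul_add, ha, hb]
      | hs h d => simp [single_mul, starHom_single, mul_comm]
  star_add a b := map_add starHom a b

theorem star_single (g : FreeGroup X) (c : ℂ) :
    star (single g c) = single g⁻¹ (star c) := starHom_single g c

instance : StarModule ℂ (FreeUnitaryAlgebra X) where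
  star_smul c a := by
    induction a using induction with
    | h0 => simp
    | hs g d => simp [smul_single, star_single]
    | ha a b ha hb => simp [smul_add, ha, hb]

theorem seminorm_single_le (p : CStarSeminorm (FreeUnitaryAlgebra X)) (g : FreeGroup X) (c : ℂ) :
    p (single g c) ≤ ‖c‖ := by
  have h1 : p 1 ≤ 1 := by
    have := p.star_mul_self 1
    simp only [star_one, mul_one] at this
    nlinarith
  have h2 : p (single g 1) ≤ 1 := by
    have := p.star_mul_self (single g 1)
    rw [star_single, single_mul] at this
    simp only [inv_mul_cancel, star_one, mul_one, ← one_def] at this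
    nlinarith [p.nonneg (single g 1)]
  have h3 := p.smul c (single g 1)
  rw [smul_single, mul_one] at h3
  rw [h3]
  exact mul_le_of_le_one_right (norm_nonneg c) h2

theorem exists_seminorm_le (a : FreeUnitaryAlgebra X) :
    ∃ M, ∀ p : CStarSeminorm (FreeUnitaryAlgebra X), p a ≤ M := by
  induction a using induction with
  | h0 => exact ⟨0, fun p => p.zero.le⟩
  | hs g c => exact ⟨‖c‖, fun p => seminorm_single_le p g c⟩
  | ha a b ha hb =>
    obtain ⟨M, hM⟩ := ha
    obtain ⟨N, hN⟩ := hb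
    exact ⟨M + N, fun p => (p.add_le a b).trans (add_le_add (hM p) (hN p))⟩

end FreeUnitaryAlgebra

section Torus

variable {n : ℕ} (θ : Matrix (Fin n) (Fin n) ℝ)

/-- The phase `ω_{ij} = exp (2 π i θ_{ij})`. -/
def torusPhase (i j : Fin n) : ℂ := Complex.exp (2 * Real.pi * Complex.I * (θ i j : ℂ))

/-- A C*-seminorm on the *-algebra of `n` free unitaries is compatible with `θ` if the relations
`x_i x_j = ω_{ij} x_j x_i` hold modulo its kernel. The index set is lifted to an arbitrary
universe only in order to have the torus in that universe. -/
def TorusRelations (p : CStarSeminorm (FreeUnitaryAlgebra (ULift.{u} (Fin n)))) : Prop :=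
  ∀ i j : Fin n, p (FreeUnitaryAlgebra.gen (ULift.up i) * FreeUnitaryAlgebra.gen (ULift.up j) -
    torusPhase θ i j •
      (FreeUnitaryAlgebra.gen (ULift.up j) * FreeUnitaryAlgebra.gen (ULift.up i))) = 0

/-- The universal C*-seminorm for the relations of the noncommutative torus: the supremum of all
C*-seminorms for which the relations hold. -/
def torusSeminorm : CStarSeminorm (FreeUnitaryAlgebra (ULift.{u} (Fin n))) :=
  CStarSeminorm.iSup
    (fun p : {p : CStarSeminorm (FreeUnitaryAlgebra (ULift.{u} (Fin n))) // TorusRelations θ p} =>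
      p.1)
    (fun a => by
      obtain ⟨M, hM⟩ := FreeUnitaryAlgebra.exists_seminorm_le a
      exact ⟨M, by rintro _ ⟨p, rfl⟩; exact hM p.1⟩)

/-- The noncommutative `n`-torus `C(𝕋_θ^n)`: the universal C*-algebra generated by unitaries
`x_1, …, x_n` subject to `x_i x_j = ω_{ij} x_j x_i`. -/
def NCTorus : Type u := (torusSeminorm.{u} θ).Completion

instance : CStarAlgebra (NCTorus.{u} θ) :=
  inferInstanceAs (CStarAlgebra (torusSeminorm.{u} θ).Completion)

/-- The canonical *-homomorphism from the *-algebra of `n` free unitaries. -/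
def torusOf : FreeUnitaryAlgebra (ULift.{u} (Fin n)) →⋆ₐ[ℂ] NCTorus.{u} θ :=
  (torusSeminorm.{u} θ).ofHom

/-- The generating unitaries `x_i` of the noncommutative torus. -/
def torusGen (i : Fin n) : NCTorus.{u} θ :=
  torusOf θ (FreeUnitaryAlgebra.gen (ULift.up i))

theorem torusGen_mem_unitary (i : Fin n) : torusGen.{u} θ i ∈ unitary (NCTorus.{u} θ) := by
  have h1 : star (FreeUnitaryAlgebra.gen (ULift.up.{u} i)) *
      FreeUnitaryAlgebra.gen (ULift.up i) = 1 := by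
    rw [FreeUnitaryAlgebra.gen, FreeUnitaryAlgebra.star_single, FreeUnitaryAlgebra.single_mul]
    simp [FreeUnitaryAlgebra.one_def]
  have h2 : FreeUnitaryAlgebra.gen (ULift.up.{u} i) *
      star (FreeUnitaryAlgebra.gen (ULift.up i)) = 1 := by
    rw [FreeUnitaryAlgebra.gen, FreeUnitaryAlgebra.star_single, FreeUnitaryAlgebra.single_mul]
    simp [FreeUnitaryAlgebra.one_def]
  rw [Unitary.mem_iff]
  unfold torusGen
  rw [← map_star, ← map_mul, ← map_mul, h1, h2, map_one]
  exact ⟨rfl, rfl⟩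

theorem torusGen_mul_torusGen (i j : Fin n) :
    torusGen.{u} θ i * torusGen θ j = torusPhase θ i j • (torusGen θ j * torusGen θ i) := by
  have h : torusOf.{u} θ
      (FreeUnitaryAlgebra.gen (ULift.up i) * FreeUnitaryAlgebra.gen (ULift.up j) -
        torusPhase θ i j •
          (FreeUnitaryAlgebra.gen (ULift.up j) * FreeUnitaryAlgebra.gen (ULift.up i))) = 0 := by
    rw [← norm_eq_zero]
    refine ((torusSeminorm.{u} θ).norm_toCompletion _).trans ?_
    refine le_antisymm ?_ (CStarSeminorm.nonneg _ _)
    exact Real.iSup_le (fun p => (p.2 i j).le) le_rfl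
  rw [map_sub, map_mul, map_smul, map_mul] at h
  exact sub_eq_zero.mp h

/-- The universal property of the noncommutative torus. -/
theorem NCTorus.exists_hom {C : Type v} [CStarAlgebra C] (y : Fin n → unitary C)
    (hy : ∀ i j, (y i : C) * y j = torusPhase θ i j • ((y j : C) * y i)) :
    ∃ f : NCTorus.{u} θ →⋆ₐ[ℂ] C, ∀ i, f (torusGen θ i) = y i := by
  let φ : FreeGroup (ULift.{u} (Fin n)) →* unitary C := FreeGroup.lift (fun i => y i.down)
  let F₀ : FreeUnitaryAlgebra (ULift.{u} (Fin n)) →ₐ[ℂ] C :=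
    MonoidAlgebra.lift ℂ C (FreeGroup (ULift.{u} (Fin n))) ((unitary C).subtype.comp φ)
  have h0 : ∀ g c, F₀ (FreeUnitaryAlgebra.single g c) = c • (φ g : C) :=
    fun g c => MonoidAlgebra.lift_single _ _ _
  let F : FreeUnitaryAlgebra (ULift.{u} (Fin n)) →⋆ₐ[ℂ] C :=
    { F₀ with
      map_star' := fun a => by
        change F₀ (star a) = star (F₀ a)
        induction a using FreeUnitaryAlgebra.induction with
        | h0 => simp
        | hs g c =>
          rw [FreeUnitaryAlgebra.star_single, h0, h0, star_smul, map_inv]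
          rfl
        | ha a b ha hb => simp [ha, hb] }
  have hg : ∀ i, F (FreeUnitaryAlgebra.gen (ULift.up i)) = y i := fun i => by
    change F₀ (FreeUnitaryAlgebra.single _ _) = _
    rw [h0]
    simp [φ]
  refine ⟨(torusSeminorm.{u} θ).lift F (fun a => ?_), fun i => ?_⟩
  · have hr : TorusRelations θ (CStarSeminorm.ofStarAlgHom F) := by
      intro i j
      change ‖F _‖ = 0
      rw [map_sub, map_mul, map_smul, map_mul, hg, hg, hy, sub_self, norm_zero]
    exact CStarSeminorm.le_iSup
      (fun p : {p : CStarSeminorm (FreeUnitaryAlgebra (ULift.{u} (Fin n))) //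
        TorusRelations θ p} => p.1) _ ⟨_, hr⟩ a
  · exact ((torusSeminorm.{u} θ).lift_ofHom F _ _).trans (hg i)

/-- The irreducible words `x_{i_1} ⋯ x_{i_p} x_{j_q}^* ⋯ x_{j_1}^*` with `i_k ≠ j_l`
for all `k`, `l`. -/
def torusWords (p q : ℕ) : Set (NCTorus.{u} θ) :=
  {w | ∃ (i : Fin p → Fin n) (j : Fin q → Fin n), (∀ k l, i k ≠ j l) ∧
    w = (List.ofFn fun k => torusGen θ (i k)).prod *
      star (List.ofFn fun l => torusGen θ (j l)).prod}

/-- The spaces of the orthogonal filtration of the noncommutative torus: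
`V_{p,q}` is the linear span of the irreducible words with `p` generators and `q` adjoints of
generators; in particular `V_{0,0} = ℂ 1`. -/
def torusFiltration (p q : ℕ) : Submodule ℂ (NCTorus.{u} θ) :=
  Submodule.span ℂ (torusWords θ p q)

end Torus

/-! ## The minimal tensor product -/

/-- The Hilbert space tensor product. -/
def HilbertTensor (H K : Type u) [NormedAddCommGroup H] [InnerProductSpace ℂ H]
    [NormedAddCommGroup K] [InnerProductSpace ℂ K] : Type u :=
  UniformSpace.Completion (H ⊗[ℂ] K)

namespace HilbertTensor

variable {H K : Type u} [NormedAddCommGroup H] [InnerProductSpace ℂ H]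
  [NormedAddCommGroup K] [InnerProductSpace ℂ K]

instance : NormedAddCommGroup (HilbertTensor H K) :=
  inferInstanceAs (NormedAddCommGroup (UniformSpace.Completion (H ⊗[ℂ] K)))
instance : InnerProductSpace ℂ (HilbertTensor H K) :=
  inferInstanceAs (InnerProductSpace ℂ (UniformSpace.Completion (H ⊗[ℂ] K)))
instance : CompleteSpace (HilbertTensor H K) :=
  inferInstanceAs (CompleteSpace (UniformSpace.Completion (H ⊗[ℂ] K)))

/-- The canonical map of the algebraic tensor product into the Hilbert space tensor product. -/
def of (x : H ⊗[ℂ] K) : HilbertTensor H K :=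
  UniformSpace.Completion.coe' (α := H ⊗[ℂ] K) x

theorem denseRange_of : DenseRange (of : H ⊗[ℂ] K → HilbertTensor H K) :=
  UniformSpace.Completion.denseRange_coe (α := H ⊗[ℂ] K)

theorem inner_of (x y : H ⊗[ℂ] K) : inner ℂ (of x) (of y) = inner ℂ x y :=
  UniformSpace.Completion.inner_coe (E := H ⊗[ℂ] K) x y

theorem of_add (x y : H ⊗[ℂ] K) : of (x + y) = of x + of y :=
  UniformSpace.Completion.coe_add (α := H ⊗[ℂ] K) x y

theorem of_smul (c : ℂ) (x : H ⊗[ℂ] K) : of (c • x) = c • of x :=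
  UniformSpace.Completion.coe_smul (X := H ⊗[ℂ] K) c x

theorem of_zero : of (0 : H ⊗[ℂ] K) = 0 := rfl

/-- The bounded operator `S ⊗ T`. -/
def map (S : H →L[ℂ] H) (T : K →L[ℂ] K) : HilbertTensor H K →L[ℂ] HilbertTensor H K :=
  ContinuousLinearMap.completion (α := H ⊗[ℂ] K) (β := H ⊗[ℂ] K) (TensorProduct.mapL S T)

theorem map_of (S : H →L[ℂ] H) (T : K →L[ℂ] K) (x : H) (y : K) :
    map S T (of (x ⊗ₜ y)) = of (S x ⊗ₜ T y) :=
  ContinuousLinearMap.completion_apply_coe _ _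

theorem ext_of {S T : HilbertTensor H K →L[ℂ] HilbertTensor H K}
    (h : ∀ x y, S (of (x ⊗ₜ y)) = T (of (x ⊗ₜ y))) : S = T := by
  apply DFunLike.coe_injective
  refine denseRange_of.equalizer S.continuous T.continuous (funext fun z => ?_)
  induction z using TensorProduct.induction_on with
  | zero => simp [of_zero]
  | tmul x y => exact h x y
  | add x y hx hy =>
    simp only [Function.comp_apply] at hx hy ⊢
    rw [of_add, map_add, map_add, hx, hy]

theorem norm_map_le (S : H →L[ℂ] H) (T : K →L[ℂ] K) : ‖map S T‖ ≤ ‖S‖ * ‖T‖ := by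
  refine ContinuousLinearMap.opNorm_le_bound _ (by positivity) fun x => ?_
  refine denseRange_of.induction_on x
    (isClosed_le ((map S T).continuous.norm) (continuous_const.mul continuous_norm)) fun z => ?_
  have h : map S T (of z) = of (TensorProduct.mapL S T z) :=
    ContinuousLinearMap.completion_apply_coe _ _
  have h2 : ∀ w : H ⊗[ℂ] K, ‖of w‖ = ‖w‖ :=
    fun w => UniformSpace.Completion.norm_coe (E := H ⊗[ℂ] K) w
  rw [h, h2, h2]
  exact (ContinuousLinearMap.le_opNorm _ _).trans
    (mul_le_mul_of_nonneg_right (TensorProduct.norm_mapL_le S T) (norm_nonneg _))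

theorem map_one_one : map (1 : H →L[ℂ] H) (1 : K →L[ℂ] K) = 1 :=
  ext_of fun x y => by simp [map_of]

theorem map_mul_map (S S' : H →L[ℂ] H) (T T' : K →L[ℂ] K) :
    map S T * map S' T' = map (S * S') (T * T') :=
  ext_of fun x y => by simp [map_of]

theorem map_add_left (S S' : H →L[ℂ] H) (T : K →L[ℂ] K) :
    map (S + S') T = map S T + map S' T :=
  ext_of fun x y => by simp [map_of, TensorProduct.add_tmul, of_add]

theorem map_add_right (S : H →L[ℂ] H) (T T' : K →L[ℂ] K) :
    map S (T + T') = map S T + map S T' :=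
  ext_of fun x y => by simp [map_of, TensorProduct.tmul_add, of_add]

theorem map_smul_left (c : ℂ) (S : H →L[ℂ] H) (T : K →L[ℂ] K) :
    map (c • S) T = c • map S T :=
  ext_of fun x y => by simp [map_of, ← TensorProduct.smul_tmul', of_smul]

theorem map_smul_right (c : ℂ) (S : H →L[ℂ] H) (T : K →L[ℂ] K) :
    map S (c • T) = c • map S T :=
  ext_of fun x y => by simp [map_of, of_smul]

theorem star_map [CompleteSpace H] [CompleteSpace K] (S : H →L[ℂ] H) (T : K →L[ℂ] K) :
    star (map S T) = map (star S) (star T) := by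
  symm
  rw [ContinuousLinearMap.star_eq_adjoint (map S T), ContinuousLinearMap.eq_adjoint_iff]
  intro x y
  refine denseRange_of.induction_on₂
    (p := fun x y => inner ℂ (map (star S) (star T) x) y = inner ℂ x (map S T y))
    (isClosed_eq (by fun_prop) (by fun_prop)) (fun x y => ?_) x y
  induction x using TensorProduct.induction_on with
  | zero => simp [of_zero]
  | add x x' hx hx' => simp only [of_add, map_add, inner_add_left, hx, hx']
  | tmul a b =>
    induction y using TensorProduct.induction_on with
    | zero => simp [of_zero]
    | add y y' hy hy' => simp only [of_add, map_add, inner_add_right, hy, hy']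
    | tmul c d =>
      simp [map_of, inner_of, ContinuousLinearMap.star_eq_adjoint,
        ContinuousLinearMap.adjoint_inner_left]

end HilbertTensor

/-- A representation of a C*-algebra on a Hilbert space. -/
structure HilbertRep (A : Type u) [CStarAlgebra A] : Type (u + 1) where
  H : Type u
  [normedInst : NormedAddCommGroup H]
  [innerInst : InnerProductSpace ℂ H]
  [completeInst : CompleteSpace H]
  hom : A →⋆ₐ[ℂ] (H →L[ℂ] H)

attribute [instance] HilbertRep.normedInst HilbertRep.innerInst HilbertRep.completeInst

namespace HilbertRep

variable {A B : Type u} [CStarAlgebra A] [CStarAlgebra B]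

/-- The algebra homomorphism underlying `tensor`. -/
def tensorAlgHom (π : HilbertRep A) (ρ : HilbertRep B) :
    A ⊗[ℂ] B →ₐ[ℂ] (HilbertTensor π.H ρ.H →L[ℂ] HilbertTensor π.H ρ.H) :=
  Algebra.TensorProduct.lift
    { toFun := fun a => HilbertTensor.map (π.hom a) 1
      map_one' := by rw [map_one, HilbertTensor.map_one_one]
      map_mul' := fun a b => by rw [map_mul, HilbertTensor.map_mul_map, one_mul]
      map_zero' := by
        simpa using HilbertTensor.map_smul_left 0 (0 : π.H →L[ℂ] π.H) (1 : ρ.H →L[ℂ] ρ.H)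
      map_add' := fun a b => by rw [map_add, HilbertTensor.map_add_left]
      commutes' := fun c => by
        rw [Algebra.algebraMap_eq_smul_one, map_smul, map_one, HilbertTensor.map_smul_left,
          HilbertTensor.map_one_one, Algebra.algebraMap_eq_smul_one] }
    { toFun := fun b => HilbertTensor.map 1 (ρ.hom b)
      map_one' := by rw [map_one, HilbertTensor.map_one_one]
      map_mul' := fun a b => by rw [map_mul, HilbertTensor.map_mul_map, one_mul]
      map_zero' := by
        simpa using HilbertTensor.map_smul_right 0 (1 : π.H →L[ℂ] π.H) (0 : ρ.H →L[ℂ] ρ.H)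
      map_add' := fun a b => by rw [map_add, HilbertTensor.map_add_right]
      commutes' := fun c => by
        rw [Algebra.algebraMap_eq_smul_one, map_smul, map_one, HilbertTensor.map_smul_right,
          HilbertTensor.map_one_one, Algebra.algebraMap_eq_smul_one] }
    (fun a b => by
      change HilbertTensor.map (π.hom a) 1 * HilbertTensor.map 1 (ρ.hom b) =
        HilbertTensor.map 1 (ρ.hom b) * HilbertTensor.map (π.hom a) 1
      simp only [HilbertTensor.map_mul_map, mul_one, one_mul])

theorem tensorAlgHom_tmul (π : HilbertRep A) (ρ : HilbertRep B) (a : A) (b : B) :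
    π.tensorAlgHom ρ (a ⊗ₜ b) = HilbertTensor.map (π.hom a) (ρ.hom b) := by
  have h : π.tensorAlgHom ρ (a ⊗ₜ b) =
      HilbertTensor.map (π.hom a) 1 * HilbertTensor.map 1 (ρ.hom b) :=
    Algebra.TensorProduct.lift_tmul _ _ _ _ _
  rw [h, HilbertTensor.map_mul_map, mul_one, one_mul]

/-- For representations `π` of `A` on `H` and `ρ` of `B` on `K`, the representation `π ⊗ ρ` of the
algebraic tensor product of `A` and `B` on the Hilbert space tensor product of `H` and `K`. -/
def tensor (π : HilbertRep A) (ρ : HilbertRep B) :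
    A ⊗[ℂ] B →⋆ₐ[ℂ] (HilbertTensor π.H ρ.H →L[ℂ] HilbertTensor π.H ρ.H) where
  __ := π.tensorAlgHom ρ
  map_star' t := by
    change π.tensorAlgHom ρ (star t) = star (π.tensorAlgHom ρ t)
    induction t using TensorProduct.induction_on with
    | zero => simp
    | add s t hs ht => rw [star_add, map_add, map_add, star_add, hs, ht]
    | tmul a b =>
      rw [TensorProduct.star_tmul, tensorAlgHom_tmul, tensorAlgHom_tmul, map_star, map_star,
        HilbertTensor.star_map]

theorem tensor_tmul (π : HilbertRep A) (ρ : HilbertRep B) (a : A) (b : B) :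
    π.tensor ρ (a ⊗ₜ b) = HilbertTensor.map (π.hom a) (ρ.hom b) := π.tensorAlgHom_tmul ρ a b

/-- The C*-seminorm `t ↦ ‖(π ⊗ ρ) t‖` on the algebraic tensor product. -/
def tensorSeminorm (π : HilbertRep A) (ρ : HilbertRep B) : CStarSeminorm (A ⊗[ℂ] B) :=
  CStarSeminorm.ofStarAlgHom (π.tensor ρ)

theorem tensorSeminorm_apply (π : HilbertRep A) (ρ : HilbertRep B) (t : A ⊗[ℂ] B) :
    π.tensorSeminorm ρ t = ‖π.tensor ρ t‖ := rfl

theorem tensorSeminorm_tmul_le (π : HilbertRep A) (ρ : HilbertRep B) (a : A) (b : B) :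
    π.tensorSeminorm ρ (a ⊗ₜ b) ≤ ‖a‖ * ‖b‖ := by
  rw [tensorSeminorm_apply, tensor_tmul]
  exact (HilbertTensor.norm_map_le _ _).trans (mul_le_mul
    (NonUnitalStarAlgHom.norm_apply_le π.hom a) (NonUnitalStarAlgHom.norm_apply_le ρ.hom b)
    (norm_nonneg _) (norm_nonneg _))

/-- The representation `a ↦ π (f a)`. -/
def comp (π : HilbertRep B) (f : A →⋆ₐ[ℂ] B) : HilbertRep A where
  H := π.H
  hom := π.hom.comp f

end HilbertRep

section MinTensor

/-- The spatial (minimal) C*-norm on the algebraic tensor product of two C*-algebras: the supremum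
of `‖(π ⊗ ρ) t‖` over all representations `π` of `A` and `ρ` of `B` on Hilbert spaces. -/
def minSeminorm (A B : Type u) [CStarAlgebra A] [CStarAlgebra B] : CStarSeminorm (A ⊗[ℂ] B) :=
  CStarSeminorm.iSup
    (fun r : HilbertRep A × HilbertRep B => r.1.tensorSeminorm r.2)
    (fun t => by
      induction t using TensorProduct.induction_on with
      | zero => exact ⟨0, by rintro _ ⟨r, rfl⟩; exact (CStarSeminorm.zero _).le⟩
      | tmul a b =>
        exact ⟨‖a‖ * ‖b‖, by rintro _ ⟨r, rfl⟩; exact r.1.tensorSeminorm_tmul_le r.2 a b⟩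
      | add s t hs ht =>
        obtain ⟨M, hM⟩ := hs
        obtain ⟨N, hN⟩ := ht
        refine ⟨M + N, ?_⟩
        rintro _ ⟨r, rfl⟩
        exact (CStarSeminorm.add_le _ s t).trans (add_le_add (hM ⟨r, rfl⟩) (hN ⟨r, rfl⟩)))

/-- The minimal tensor product of two unital C*-algebras. -/
def MinTensor (A B : Type u) [CStarAlgebra A] [CStarAlgebra B] : Type u :=
  (minSeminorm A B).Completion

infixl:70 " ⊗ₘ " => MinTensor

variable {A B A' B' : Type u} [CStarAlgebra A] [CStarAlgebra B] [CStarAlgebra A'] [CStarAlgebra B']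

instance : CStarAlgebra (A ⊗ₘ B) := inferInstanceAs (CStarAlgebra (minSeminorm A B).Completion)

namespace MinTensor

/-- The canonical *-homomorphism from the algebraic to the minimal tensor product. -/
def ofAlg : A ⊗[ℂ] B →⋆ₐ[ℂ] A ⊗ₘ B := (minSeminorm A B).ofHom

/-- The elementary tensor `a ⊗ b`. -/
def tmul (a : A) (b : B) : A ⊗ₘ B := ofAlg (a ⊗ₜ b)

/-- The *-homomorphism `f ⊗ g` of algebraic tensor products. -/
def algMap (f : A →⋆ₐ[ℂ] A') (g : B →⋆ₐ[ℂ] B') : A ⊗[ℂ] B →⋆ₐ[ℂ] A' ⊗[ℂ] B' where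
  __ := Algebra.TensorProduct.map (f : A →ₐ[ℂ] A') (g : B →ₐ[ℂ] B')
  map_star' t := by
    change Algebra.TensorProduct.map (f : A →ₐ[ℂ] A') (g : B →ₐ[ℂ] B') (star t) =
      star (Algebra.TensorProduct.map (f : A →ₐ[ℂ] A') (g : B →ₐ[ℂ] B') t)
    induction t using TensorProduct.induction_on with
    | zero => simp
    | add s t hs ht => rw [star_add, map_add, map_add, star_add, hs, ht]
    | tmul a b => simp [map_star]

theorem algMap_tmul (f : A →⋆ₐ[ℂ] A') (g : B →⋆ₐ[ℂ] B') (a : A) (b : B) :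
    algMap f g (a ⊗ₜ b) = f a ⊗ₜ g b := rfl

theorem minSeminorm_algMap_le (f : A →⋆ₐ[ℂ] A') (g : B →⋆ₐ[ℂ] B') (t : A ⊗[ℂ] B) :
    minSeminorm A' B' (algMap f g t) ≤ minSeminorm A B t := by
  refine Real.iSup_le (fun r => ?_) ((minSeminorm A B).nonneg t)
  have h : r.1.tensorSeminorm r.2 (algMap f g t) =
      (r.1.comp f).tensorSeminorm (r.2.comp g) t := by
    have h2 : r.1.tensor r.2 (algMap f g t) = (r.1.comp f).tensor (r.2.comp g) t := by
      induction t using TensorProduct.induction_on with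
      | zero => simp only [map_zero]; rfl
      | add s t hs ht => rw [map_add, map_add, map_add, hs, ht]; rfl
      | tmul a b => rw [algMap_tmul, HilbertRep.tensor_tmul, HilbertRep.tensor_tmul]; rfl
    rw [HilbertRep.tensorSeminorm_apply, h2]
    rfl
  rw [h]
  exact CStarSeminorm.le_iSup (fun r : HilbertRep A × HilbertRep B => r.1.tensorSeminorm r.2) _
    (r.1.comp f, r.2.comp g) t

/-- The *-homomorphism `f ⊗ g : A ⊗ B → A' ⊗ B'` of minimal tensor products. -/
def map (f : A →⋆ₐ[ℂ] A') (g : B →⋆ₐ[ℂ] B') : A ⊗ₘ B →⋆ₐ[ℂ] A' ⊗ₘ B' :=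
  (minSeminorm A B).lift (ofAlg.comp (algMap f g)) (fun t =>
    ((minSeminorm A' B').norm_toCompletion (algMap f g t)).le.trans (minSeminorm_algMap_le f g t))

theorem map_tmul (f : A →⋆ₐ[ℂ] A') (g : B →⋆ₐ[ℂ] B') (a : A) (b : B) :
    map f g (tmul a b) = tmul (f a) (g b) :=
  (minSeminorm A B).lift_ofHom _ _ _

end MinTensor

end MinTensor

/-! ## Compact quantum groups and their coactions -/

section QuantumGroup

/-- `φ` is the canonical *-homomorphism `(A ⊗ B) ⊗ C → A ⊗ (B ⊗ C)`. It exists, and it is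
determined by its values on elementary tensors, since these span a dense subspace. -/
def IsAssociator {A B C : Type u} [CStarAlgebra A] [CStarAlgebra B] [CStarAlgebra C]
    (φ : (A ⊗ₘ B) ⊗ₘ C →⋆ₐ[ℂ] A ⊗ₘ (B ⊗ₘ C)) : Prop :=
  ∀ a b c, φ (MinTensor.tmul (MinTensor.tmul a b) c) = MinTensor.tmul a (MinTensor.tmul b c)

/-- The identity `(α ⊗ id) α = (id ⊗ Δ) α`, where `(B ⊗ A) ⊗ A` is identified with `B ⊗ (A ⊗ A)`. -/
def Coassociative {A B : Type u} [CStarAlgebra A] [CStarAlgebra B]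
    (Δ : A →⋆ₐ[ℂ] A ⊗ₘ A) (α : B →⋆ₐ[ℂ] B ⊗ₘ A) : Prop :=
  ∃ φ : (B ⊗ₘ A) ⊗ₘ A →⋆ₐ[ℂ] B ⊗ₘ (A ⊗ₘ A), IsAssociator φ ∧
    ∀ b, φ (MinTensor.map α (StarAlgHom.id ℂ A) (α b)) =
      MinTensor.map (StarAlgHom.id ℂ B) Δ (α b)

/-- A compact quantum group with algebra `A`. -/
structure CompactQuantumGroup (A : Type u) [CStarAlgebra A] where
  /-- The comultiplication. -/
  comul : A →⋆ₐ[ℂ] A ⊗ₘ A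
  coassoc : Coassociative comul comul
  /-- `Δ(A)(1 ⊗ A)` is dense. -/
  dense_right : Dense (Submodule.span ℂ
    {t | ∃ a b : A, t = comul a * MinTensor.tmul 1 b} : Set (A ⊗ₘ A))
  /-- `Δ(A)(A ⊗ 1)` is dense. -/
  dense_left : Dense (Submodule.span ℂ
    {t | ∃ a b : A, t = comul a * MinTensor.tmul b 1} : Set (A ⊗ₘ A))

/-- A coaction of a compact quantum group on a unital C*-algebra `B`. -/
structure Coaction {A : Type u} [CStarAlgebra A] (G : CompactQuantumGroup A)
    (B : Type u) [CStarAlgebra B] where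
  hom : B →⋆ₐ[ℂ] B ⊗ₘ A
  coassoc : Coassociative G.comul hom
  /-- `α(B)(1 ⊗ A)` is dense. -/
  dense : Dense (Submodule.span ℂ
    {t | ∃ (b : B) (a : A), t = hom b * MinTensor.tmul 1 a} : Set (B ⊗ₘ A))

/-- The algebraic tensor product `V ⊗ A` of a subspace `V` of `B` with `A`, inside `B ⊗ A`. -/
def algTensorSubspace {B : Type u} [CStarAlgebra B] (V : Submodule ℂ B) (A : Type u)
    [CStarAlgebra A] : Submodule ℂ (B ⊗ₘ A) :=
  Submodule.span ℂ {t | ∃ v ∈ V, ∃ a : A, t = MinTensor.tmul v a}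

/-- A coaction on `B` preserves a family of subspaces `V_i` if `α(V_i) ⊆ V_i ⊗ A` for all `i`,
with the algebraic tensor product on the right. -/
def Coaction.Preserves {A : Type u} [CStarAlgebra A] {G : CompactQuantumGroup A}
    {B : Type u} [CStarAlgebra B] (α : Coaction G B) {I : Type v} (V : I → Submodule ℂ B) : Prop :=
  ∀ i, ∀ v ∈ V i, α.hom v ∈ algTensorSubspace (V i) A

end QuantumGroup

end

/-! ## Vector functionals and slices -/

/-! The whole theorem is a comparison of coefficients for the grading of the torus by `ℤⁿ`, in which
`x_i` has degree `ε_i`. Since `V_{1,0}` is spanned by the generators, `α(x_k)` has the form `∑ x_i ⊗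
u_ik`. Applying `α` to relations among the `x_k` gives equations in the minimal tensor product, and
each asserted identity is one graded component of such an equation. The relation `x_k x_l = ω_kl x_l
x_k` is read in degree `ε_i + ε_j`, where exactly the products `x_i x_j` and `x_j x_i` live; this
explains the four-term relation. The equations `x_k x_k^* = 1 = x_k^* x_k` are read in degree `ε_i -
ε_j ≠ 0`, where only one product lives and the right side has no component; this gives the vanishing
relations. In degree 0 they give the sums equal to 1. For `k ≠ l`, `α(x_k x_l^*)` lies in `V_{1,1} ⊗
A`, which has no component of degree 0; this gives the sums equal to 0.

Components are extracted by functionals `b ↦ ⟪e_d, π(b) e_0⟫`, where `π` represents the torus by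
weighted shifts on `ℓ²(ℤⁿ)` (`exists_hilbertRep_shift`). Their slice maps are applied through matrix
coefficients of `π ⊗ ρ`, with `ρ` running over the representations of `A`; these separate points by
Hahn–Banach and the GNS construction (`exists_hom_ne_zero`). The resulting principle is
`sum_vectorFunctional_smul_eq_zero`. -/

section PositiveFunctionals

open scoped ComplexOrder

/-- The positive linear functionals on a C*-algebra separate its points. -/
theorem exists_positiveLinearMap_star_mul_self_ne_zero {A : Type u} [CStarAlgebra A]
    [PartialOrder A] [StarOrderedRing A] {a : A} (ha : a ≠ 0) :
    ∃ φ : A →ₚ[ℂ] ℂ, φ (star a * a) ≠ 0 := by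
  let C : ProperCone ℝ A :=
    { carrier := {x | 0 ≤ x}
      add_mem' := fun hx hy => add_nonneg hx hy
      zero_mem' := le_rfl
      smul_mem' := fun c x hx => smul_nonneg c.2 hx
      isClosed' := CStarAlgebra.isClosed_nonneg }
  have hC : -(star a * a) ∉ C := by
    intro h
    have h1 : (0 : A) ≤ -(star a * a) := h
    have h2 : star a * a = 0 := le_antisymm (neg_nonneg.mp h1) (star_mul_self_nonneg a)
    exact ha ((CStarRing.star_mul_self_eq_zero_iff a).mp h2)
  -- Hahn–Banach separates `-a^*a` from the closed cone of positive elements by a real functional,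
  -- nonnegative on the cone and negative at `-a^*a`.
  obtain ⟨f, hf, hf0⟩ := C.hyperplane_separation_point hC
  -- Symmetrising `f` under the involution makes `g` vanish on `i • x` for self-adjoint `x`, so the
  -- complex extension `x ↦ g x - i g (i x)` is real there and equals `2 f x`.
  let g : A →ₗ[ℝ] ℝ :=
    { toFun := fun x => f x + f (star x)
      map_add' := fun x y => by simp only [star_add, map_add]; ring
      map_smul' := fun c x => by
        simp only [star_smul, map_smul, star_trivial, smul_eq_mul, RingHom.id_apply]; ring }
  have hgI : ∀ x : A, IsSelfAdjoint x → g (Complex.I • x) = 0 := by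
    intro x hx
    change f _ + f _ = 0
    rw [star_smul, hx.star_eq, ← map_add, ← add_smul]
    simp
  let F : A →ₗ[ℂ] ℂ := Module.Dual.extendRCLike g
  have hF : ∀ x : A, IsSelfAdjoint x → F x = ((2 * f x : ℝ) : ℂ) := by
    intro x hx
    have h1 : F x = (g x : ℂ) - Complex.I * (g (Complex.I • x) : ℂ) :=
      Module.Dual.extendRCLike_apply g x
    have h2 : g x = 2 * f x := by
      change f x + f (star x) = _
      rw [hx.star_eq]; ring
    rw [h1, hgI x hx, h2]
    simp
  have hpos : ∀ x : A, 0 ≤ x → 0 ≤ F x := by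
    intro x hx
    rw [hF x (IsSelfAdjoint.of_nonneg hx)]
    exact_mod_cast mul_nonneg zero_le_two (hf x hx)
  refine ⟨PositiveLinearMap.mk₀ F hpos, ?_⟩
  change F (star a * a) ≠ 0
  rw [hF _ (IsSelfAdjoint.star_mul_self a)]
  rw [map_neg] at hf0
  have : 2 * f (star a * a) ≠ 0 := by linarith [hf0] |> fun h : 0 < 2 * f (star a * a) => h.ne'
  exact_mod_cast this

end PositiveFunctionals

/-! ### Algebra of elementary tensors. -/

namespace MinTensor

variable {A B : Type u} [CStarAlgebra A] [CStarAlgebra B]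

theorem tmul_add (b : B) (a a' : A) : tmul b (a + a') = tmul b a + tmul b a' := by
  simp only [tmul, TensorProduct.tmul_add, map_add]

theorem tmul_zero (b : B) : tmul b (0 : A) = 0 := by
  simp only [tmul, TensorProduct.tmul_zero, map_zero]

theorem tmul_sub (b : B) (a a' : A) : tmul b (a - a') = tmul b a - tmul b a' := by
  simp only [tmul, TensorProduct.tmul_sub, map_sub]

theorem tmul_smul (c : ℂ) (b : B) (a : A) : tmul b (c • a) = c • tmul b a := by
  simp only [tmul, TensorProduct.tmul_smul, map_smul]

theorem smul_tmul (c : ℂ) (b : B) (a : A) : tmul (c • b) a = tmul b (c • a) := by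
  simp only [tmul, TensorProduct.smul_tmul]

theorem add_tmul (b b' : B) (a : A) : tmul (b + b') a = tmul b a + tmul b' a := by
  simp only [tmul, TensorProduct.add_tmul, map_add]

theorem zero_tmul (a : A) : tmul (0 : B) a = 0 := by
  simp only [tmul, TensorProduct.zero_tmul, map_zero]

theorem tmul_mul_tmul (b b' : B) (a a' : A) :
    tmul b a * tmul b' a' = tmul (b * b') (a * a') := by
  simp only [tmul, ← map_mul, Algebra.TensorProduct.tmul_mul_tmul]

theorem star_tmul (b : B) (a : A) : star (tmul b a) = tmul (star b) (star a) := by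
  simp only [tmul, ← map_star, TensorProduct.star_tmul]

theorem one_def : (1 : B ⊗ₘ A) = tmul 1 1 :=
  (map_one (ofAlg : B ⊗[ℂ] A →⋆ₐ[ℂ] B ⊗ₘ A)).symm

end MinTensor

/-! ### Separation of points and slice maps. -/

namespace HilbertRep

variable {A B : Type u} [CStarAlgebra A] [CStarAlgebra B]

/-- The representations of a C*-algebra on Hilbert spaces separate its points. -/
theorem exists_hom_ne_zero {a : A} (ha : a ≠ 0) : ∃ ρ : HilbertRep A, ρ.hom a ≠ 0 := by
  let _ : PartialOrder A := CStarAlgebra.spectralOrder A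
  have _ : StarOrderedRing A := CStarAlgebra.spectralOrderedRing A
  obtain ⟨φ, hφ⟩ := exists_positiveLinearMap_star_mul_self_ne_zero ha
  refine ⟨{ H := φ.GNS, hom := φ.gnsStarAlgHom }, fun h => hφ ?_⟩
  -- Evaluate at the cyclic vector, the class of 1: the squared norm of its image under `a` is
  -- `φ(a^*a)`.
  have h1 : φ.gnsNonUnitalStarAlgHom a (φ.toPreGNS 1 : φ.PreGNS) = 0 := by
    have h2 : φ.gnsNonUnitalStarAlgHom a = 0 := h
    rw [h2]; rfl
  rw [PositiveLinearMap.gnsNonUnitalStarAlgHom_apply_coe] at h1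
  have h3 : ‖φ.leftMulMapPreGNS a (φ.toPreGNS 1)‖ = 0 := by
    rw [← UniformSpace.Completion.norm_coe, h1, norm_zero]
  have h4 := φ.preGNS_norm_sq (φ.leftMulMapPreGNS a (φ.toPreGNS 1))
  rw [h3] at h4
  simpa using h4.symm

theorem eq_zero_of_inner_hom_eq_zero {a : A}
    (h : ∀ (ρ : HilbertRep A) (ξ η : ρ.H), inner ℂ η (ρ.hom a ξ) = 0) : a = 0 := by
  by_contra ha
  obtain ⟨ρ, hρ⟩ := exists_hom_ne_zero ha
  exact hρ (ContinuousLinearMap.ext fun ξ => inner_self_eq_zero.mp (h ρ ξ _))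

/-- The vector functional `b ↦ ⟪ζ', π(b) ζ⟫`. -/
noncomputable def vectorFunctional (π : HilbertRep B) (ζ ζ' : π.H) : B →ₗ[ℂ] ℂ where
  toFun b := inner ℂ ζ' (π.hom b ζ)
  map_add' b c := by rw [map_add, add_apply, inner_add_right]
  map_smul' c b := by
    rw [map_smul, smul_apply, inner_smul_right]; rfl

theorem vectorFunctional_apply (π : HilbertRep B) (ζ ζ' : π.H) (b : B) :
    π.vectorFunctional ζ ζ' b = inner ℂ ζ' (π.hom b ζ) := rfl

/-- The representation `π ⊗ ρ` of the minimal tensor product. -/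
noncomputable def minTensor (π : HilbertRep B) (ρ : HilbertRep A) :
    B ⊗ₘ A →⋆ₐ[ℂ] (HilbertTensor π.H ρ.H →L[ℂ] HilbertTensor π.H ρ.H) :=
  (minSeminorm B A).lift (π.tensor ρ) fun t =>
    -- The pair `(π, ρ)` is a member of the family whose supremum is the minimal norm.
    CStarSeminorm.le_iSup (fun r : HilbertRep B × HilbertRep A => r.1.tensorSeminorm r.2) _
      (π, ρ) t

theorem minTensor_tmul (π : HilbertRep B) (ρ : HilbertRep A) (b : B) (a : A) :
    π.minTensor ρ (MinTensor.tmul b a) = HilbertTensor.map (π.hom b) (ρ.hom a) :=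
  ((minSeminorm B A).lift_ofHom _ _ _).trans (π.tensor_tmul ρ b a)

/-- Matrix coefficients of `π ⊗ ρ` at product vectors factor, so they compute the matrix
coefficients of a slice without a slice map on the completion being constructed. -/
theorem inner_minTensor_tmul (π : HilbertRep B) (ρ : HilbertRep A) (b : B) (a : A)
    (ζ ζ' : π.H) (ξ η : ρ.H) :
    inner ℂ (HilbertTensor.of (ζ' ⊗ₜ[ℂ] η))
      (π.minTensor ρ (MinTensor.tmul b a) (HilbertTensor.of (ζ ⊗ₜ[ℂ] ξ))) =
      π.vectorFunctional ζ ζ' b * inner ℂ η (ρ.hom a ξ) := by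
  rw [minTensor_tmul, HilbertTensor.map_of, HilbertTensor.inner_of,
    TensorProduct.inner_tmul, vectorFunctional_apply]

/-- If a vector functional vanishes on `V`, then so does its slice map on `V ⊗ A`. -/
theorem sum_vectorFunctional_smul_eq_zero (π : HilbertRep B) {ζ ζ' : π.H} {V : Submodule ℂ B}
    (hV : ∀ v ∈ V, π.vectorFunctional ζ ζ' v = 0) {ι : Type v} (s : Finset ι) (b : ι → B)
    (a : ι → A) (h : ∑ i ∈ s, MinTensor.tmul (b i) (a i) ∈ algTensorSubspace V A) :
    ∑ i ∈ s, π.vectorFunctional ζ ζ' (b i) • a i = 0 := by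
  refine eq_zero_of_inner_hom_eq_zero fun ρ ξ η => ?_
  -- For fixed `ρ`, `ξ`, `η` the coefficient is linear in `t` and vanishes on `v ⊗ a` with `v ∈ V`.
  have key : ∀ t ∈ algTensorSubspace V A, inner ℂ (HilbertTensor.of (ζ' ⊗ₜ[ℂ] η))
      (π.minTensor ρ t (HilbertTensor.of (ζ ⊗ₜ[ℂ] ξ))) = 0 := by
    intro t ht
    induction ht using Submodule.span_induction with
    | mem t ht =>
      obtain ⟨w, hw, c, rfl⟩ := ht
      rw [inner_minTensor_tmul, hV w hw, zero_mul]
    | zero => rw [map_zero, zero_apply, inner_zero_right]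
    | add s t _ _ hs ht =>
      rw [map_add, add_apply, inner_add_right, hs, ht, add_zero]
    | smul c t _ ht =>
      rw [map_smul, smul_apply, inner_smul_right, ht, mul_zero]
  have h1 := key _ h
  rw [map_sum, sum_apply, inner_sum] at h1
  rw [map_sum, sum_apply, inner_sum, ← h1]
  refine Finset.sum_congr rfl fun i _ => ?_
  rw [map_smul, smul_apply, inner_smul_right, inner_minTensor_tmul]

/-- Coefficients are compared modulo `V ⊗ A`: `V = ⊥` handles exact equations, and `V = V_{1,1}` the
off-diagonal products `x_k x_l^*`. -/
theorem sum_vectorFunctional_smul_eq (π : HilbertRep B) {ζ ζ' : π.H} {V : Submodule ℂ B}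
    (hV : ∀ v ∈ V, π.vectorFunctional ζ ζ' v = 0) {ι : Type v} [Fintype ι] (b : ι → B)
    (a : ι → A) (b₀ : B) (a₀ : A)
    (h : ∑ i, MinTensor.tmul (b i) (a i) - MinTensor.tmul b₀ a₀ ∈ algTensorSubspace V A) :
    ∑ i, π.vectorFunctional ζ ζ' (b i) • a i = π.vectorFunctional ζ ζ' b₀ • a₀ := by
  have h1 := π.sum_vectorFunctional_smul_eq_zero hV Finset.univ
    -- The extra index `none` carries the term `-(b₀ ⊗ a₀)`.
    (fun o : Option ι => o.elim b₀ b) (fun o => o.elim (-a₀) a) (by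
      rw [Fintype.sum_option]
      have h2 : MinTensor.tmul b₀ (-a₀) = -MinTensor.tmul b₀ a₀ := by
        rw [← zero_sub, MinTensor.tmul_sub, MinTensor.tmul_zero, zero_sub]
      change MinTensor.tmul b₀ (-a₀) + ∑ i, MinTensor.tmul (b i) (a i) ∈ _
      rwa [h2, neg_add_eq_sub])
  rw [Fintype.sum_option] at h1
  change _ • -a₀ + ∑ i, π.vectorFunctional ζ ζ' (b i) • a i = 0 at h1
  rwa [smul_neg, neg_add_eq_zero, eq_comm] at h1

end HilbertRep

/-! ## A representation of the noncommutative torus by weighted shifts -/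

/-- Weighted permutations of a Hilbert basis are unitary. -/
theorem HilbertBasis.exists_unitary_apply_eq_smul {ι : Type u} {H : Type v}
    [NormedAddCommGroup H] [InnerProductSpace ℂ H] [CompleteSpace H] (b : HilbertBasis ι ℂ H)
    (σ : Equiv.Perm ι) (z : ι → ℂ) (hz : ∀ i, ‖z i‖ = 1) :
    ∃ U : unitary (H →L[ℂ] H), ∀ i, (U : H →L[ℂ] H) (b i) = z i • b (σ i) := by
  classical
  have ho : Orthonormal ℂ fun i => z i • b (σ i) := by
    refine ⟨fun i => ?_, fun i j hij => ?_⟩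
    · rw [norm_smul, hz, one_mul, b.orthonormal.norm_eq_one]
    · change inner ℂ (z i • b (σ i)) (z j • b (σ j)) = 0
      rw [inner_smul_left, inner_smul_right,
        b.orthonormal.inner_eq_zero (fun h => hij (σ.injective h)), mul_zero, mul_zero]
  have hd : ⊤ ≤ (Submodule.span ℂ (Set.range fun i => z i • b (σ i))).topologicalClosure := by
    rw [← b.dense_span]
    refine Submodule.topologicalClosure_mono (Submodule.span_le.mpr ?_)
    rintro _ ⟨i, rfl⟩
    have h0 : z (σ.symm i) ≠ 0 := fun h => by simpa [h] using hz (σ.symm i)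
    have h1 : b i = (z (σ.symm i))⁻¹ • (z (σ.symm i) • b (σ (σ.symm i))) := by
      rw [smul_smul, inv_mul_cancel₀ h0, one_smul, Equiv.apply_symm_apply]
    rw [h1]
    exact Submodule.smul_mem _ _ (Submodule.subset_span ⟨σ.symm i, rfl⟩)
  -- The weighted, permuted family is again a Hilbert basis, and the unitary is the change of basis.
  let b' := HilbertBasis.mk ho hd
  refine ⟨Unitary.linearIsometryEquiv.symm (b.repr.trans b'.repr.symm), fun i => ?_⟩
  rw [Unitary.coe_symm_linearIsometryEquiv_apply]
  change b'.repr.symm (b.repr (b i)) = _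
  rw [b.repr_self, b'.repr_symm_single]
  exact congrFun (HilbertBasis.coe_mk ho hd) i

theorem HilbertBasis.continuousLinearMap_ext {ι : Type u} {H : Type v}
    [NormedAddCommGroup H] [InnerProductSpace ℂ H] (b : HilbertBasis ι ℂ H)
    {S T : H →L[ℂ] H} (h : ∀ i, S (b i) = T (b i)) : S = T :=
  ContinuousLinearMap.ext_on
    (Submodule.dense_iff_topologicalClosure_eq_top.mpr b.dense_span)
    (by rintro _ ⟨i, rfl⟩; exact h i)

section TorusRep

variable {n : ℕ} (θ : Matrix (Fin n) (Fin n) ℝ)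

/-- The weight of the shift representing `x_i` at the basis vector `m`. -/
noncomputable def shiftPhase (i : Fin n) (m : Fin n → ℤ) : ℂ :=
  Complex.exp ((Real.pi * ∑ j, θ i j * m j : ℝ) * Complex.I)

theorem norm_shiftPhase (i : Fin n) (m : Fin n → ℤ) : ‖shiftPhase θ i m‖ = 1 :=
  Complex.norm_exp_ofReal_mul_I _

theorem shiftPhase_ne_zero (i : Fin n) (m : Fin n → ℤ) : shiftPhase θ i m ≠ 0 :=
  Complex.exp_ne_zero _

theorem shiftPhase_add_single (i j : Fin n) (m : Fin n → ℤ) :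
    shiftPhase θ i (m + Pi.single j 1) =
      shiftPhase θ i m * Complex.exp ((Real.pi * θ i j : ℝ) * Complex.I) := by
  unfold shiftPhase
  rw [← Complex.exp_add, ← add_mul, ← Complex.ofReal_add, ← mul_add]
  congr 4
  simp only [Pi.add_apply, Int.cast_add, mul_add, Finset.sum_add_distrib]
  congr 1
  rw [Finset.sum_eq_single j (fun k _ hk => by simp [hk]) (by simp)]
  simp

/-- Moving `m` by `ε_j` multiplies the weight of `x_i` by `exp(πiθ_ij)`. Interchanging the two
shifts thus costs `exp(πi(θ_ij - θ_ji))`, which is `ω_ij` by skew-symmetry; hence `π` rather than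
`2π` in the weights. -/
theorem shiftPhase_mul_shiftPhase {θ : Matrix (Fin n) (Fin n) ℝ} (hθ : θ.transpose = -θ)
    (i j : Fin n) (m : Fin n → ℤ) :
    shiftPhase θ i (m + Pi.single j 1) * shiftPhase θ j m =
      torusPhase θ i j * (shiftPhase θ j (m + Pi.single i 1) * shiftPhase θ i m) := by
  have h : θ j i = -θ i j := congrFun (congrFun hθ i) j
  have key : Complex.exp ((Real.pi * θ i j : ℝ) * Complex.I) =
      torusPhase θ i j * Complex.exp ((Real.pi * θ j i : ℝ) * Complex.I) := by
    rw [torusPhase, ← Complex.exp_add, h]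
    congr 1
    push_cast
    ring
  rw [shiftPhase_add_single, shiftPhase_add_single, key]
  ring

theorem exists_hilbertRep_shift {θ : Matrix (Fin n) (Fin n) ℝ} (hθ : θ.transpose = -θ) :
    ∃ (π : HilbertRep (NCTorus.{u} θ)) (e : (Fin n → ℤ) → π.H), Orthonormal ℂ e ∧
      ∀ i m, π.hom (torusGen θ i) (e m) = shiftPhase θ i m • e (m + Pi.single i 1) := by
  -- `ULift` only places the Hilbert space in the universe of the torus, as `HilbertRep` demands.
  let H := lp (fun _ : ULift.{u} (Fin n → ℤ) => ℂ) 2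
  let b : HilbertBasis (ULift.{u} (Fin n → ℤ)) ℂ H :=
    HilbertBasis.ofRepr (LinearIsometryEquiv.refl ℂ _)
  let σ : Fin n → Equiv.Perm (ULift.{u} (Fin n → ℤ)) := fun i =>
    Equiv.ulift.trans ((Equiv.addRight (Pi.single i 1)).trans Equiv.ulift.symm)
  choose U hU using fun i => b.exists_unitary_apply_eq_smul (σ i)
    (fun m => shiftPhase θ i m.down) fun m => norm_shiftPhase θ i m.down
  obtain ⟨f, hf⟩ := NCTorus.exists_hom.{u} θ U (fun i j => by
    refine b.continuousLinearMap_ext fun m => ?_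
    change (U i : H →L[ℂ] H) ((U j : H →L[ℂ] H) (b m)) =
      torusPhase θ i j • (U j : H →L[ℂ] H) ((U i : H →L[ℂ] H) (b m))
    rw [hU, hU, map_smul, map_smul, hU, hU, smul_smul, smul_smul, smul_smul]
    have h1 : σ i (σ j m) = σ j (σ i m) :=
      ULift.ext _ _ (add_right_comm m.down (Pi.single j 1) (Pi.single i 1))
    have h2 := shiftPhase_mul_shiftPhase hθ i j m.down
    rw [h1, mul_comm (shiftPhase θ j m.down), mul_assoc,
      mul_comm (shiftPhase θ i m.down)]
    exact congrArg (· • b (σ j (σ i m))) h2)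
  refine ⟨{ H := H, hom := f }, fun m => b (ULift.up m),
    b.orthonormal.comp _ ULift.up_injective, fun i m => ?_⟩
  change f (torusGen θ i) (b (ULift.up m)) = _
  rw [hf, hU]
  rfl

end TorusRep

/-! ## Homogeneous elements and comparison of coefficients -/

namespace HilbertRep

variable {A B : Type u} [CStarAlgebra A] [CStarAlgebra B] {Γ : Type v} [AddCommGroup Γ]
  {π : HilbertRep B} {e : Γ → π.H}

/-- `b` acts on the family `e` by a shift by `d`, with nonzero weights. -/
def IsHomogeneous (π : HilbertRep B) (e : Γ → π.H) (b : B) (d : Γ) : Prop :=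
  ∀ m, ∃ c : ℂ, c ≠ 0 ∧ π.hom b (e m) = c • e (m + d)

theorem isHomogeneous_one : π.IsHomogeneous e 1 0 := fun m =>
  ⟨1, one_ne_zero, by rw [map_one, one_smul, add_zero]; rfl⟩

theorem IsHomogeneous.mul {b c : B} {d d' : Γ} (hb : π.IsHomogeneous e b d)
    (hc : π.IsHomogeneous e c d') : π.IsHomogeneous e (b * c) (d + d') := by
  intro m
  obtain ⟨s, hs, h1⟩ := hc m
  obtain ⟨t, ht, h2⟩ := hb (m + d')
  refine ⟨s * t, mul_ne_zero hs ht, ?_⟩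
  rw [map_mul, mul_apply_eq_comp, h1, map_smul, h2, smul_smul, add_right_comm,
    add_assoc]

/-- Unitarity inverts `b e_{m-d} = s e_m` to `b^* e_m = s⁻¹ e_{m-d}`. -/
theorem IsHomogeneous.star {b : B} {d : Γ} (hb : π.IsHomogeneous e b d) (hu : b ∈ unitary B) :
    π.IsHomogeneous e (star b) (-d) := by
  intro m
  obtain ⟨s, hs, h1⟩ := hb (m + -d)
  refine ⟨s⁻¹, inv_ne_zero hs, ?_⟩
  rw [neg_add_cancel_right] at h1
  have h2 : e m = s⁻¹ • π.hom b (e (m + -d)) := by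
    rw [h1, smul_smul, inv_mul_cancel₀ hs, one_smul]
  rw [h2, map_smul, ← mul_apply_eq_comp, ← map_mul,
    Unitary.star_mul_self_of_mem hu, map_one]
  rfl

theorem IsHomogeneous.vectorFunctional_eq_zero (he : Orthonormal ℂ e) {b : B} {d m : Γ}
    (hb : π.IsHomogeneous e b d) (h : d ≠ m) : π.vectorFunctional (e 0) (e m) b = 0 := by
  obtain ⟨s, -, h1⟩ := hb 0
  rw [vectorFunctional_apply, h1, zero_add, inner_smul_right, he.inner_eq_zero h.symm, mul_zero]

theorem IsHomogeneous.vectorFunctional_ne_zero (he : Orthonormal ℂ e) {b : B} {d : Γ}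
    (hb : π.IsHomogeneous e b d) : π.vectorFunctional (e 0) (e d) b ≠ 0 := by
  obtain ⟨s, hs, h1⟩ := hb 0
  rw [vectorFunctional_apply, h1, zero_add, inner_smul_right, inner_self_eq_norm_sq_to_K,
    he.norm_eq_one]
  simpa using hs

theorem vectorFunctional_one (he : Orthonormal ℂ e) :
    π.vectorFunctional (e 0) (e 0) 1 = 1 := by
  rw [vectorFunctional_apply, map_one, one_apply_eq_self,
    inner_self_eq_norm_sq_to_K, he.norm_eq_one]
  simp

variable {n : ℕ}

/-- Comparison of the coefficients of degree zero. -/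
theorem sum_diagonal_eq {e : (Fin n → ℤ) → π.H} (he : Orthonormal ℂ e)
    {y : Fin n → Fin n → B}
    (hy : ∀ i j, π.IsHomogeneous e (y i j) (Pi.single i 1 + -Pi.single j 1))
    (hd : ∀ i, y i i = 1) {V : Submodule ℂ B}
    (hV : ∀ v ∈ V, π.vectorFunctional (e 0) (e 0) v = 0) {c : Fin n → Fin n → A} {r : A}
    (h : ∑ i, ∑ j, MinTensor.tmul (y i j) (c i j) - MinTensor.tmul 1 r ∈
      algTensorSubspace V A) : ∑ i, c i i = r := by
  rw [← Fintype.sum_prod_type'] at h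
  have h1 := π.sum_vectorFunctional_smul_eq hV _ _ _ _ h
  rw [vectorFunctional_one he, one_smul] at h1
  rw [← h1, Fintype.sum_prod_type]
  refine Finset.sum_congr rfl fun i _ => ?_
  rw [Fintype.sum_eq_single i, hd, vectorFunctional_one he, one_smul]
  intro j hj
  rw [(hy i j).vectorFunctional_eq_zero he, zero_smul]
  intro h0
  rw [add_neg_eq_zero] at h0
  have := congrFun h0 i
  simp [hj.symm] at this

/-- Comparison of the coefficients of nonzero degree. -/
theorem eq_zero_of_sum_eq {e : (Fin n → ℤ) → π.H} (he : Orthonormal ℂ e)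
    {y : Fin n → Fin n → B}
    (hy : ∀ i j, π.IsHomogeneous e (y i j) (Pi.single i 1 + -Pi.single j 1))
    {c : Fin n → Fin n → A} {r : A}
    (h : ∑ i, ∑ j, MinTensor.tmul (y i j) (c i j) = MinTensor.tmul 1 r) {i j : Fin n}
    (hij : i ≠ j) : c i j = 0 := by
  rw [← Fintype.sum_prod_type', ← sub_eq_zero] at h
  have h1 := π.sum_vectorFunctional_smul_eq (V := ⊥) (ζ := e 0)
    (ζ' := e (Pi.single i 1 + -Pi.single j 1))
    (fun v hv => by rw [(Submodule.mem_bot ℂ).mp hv, map_zero]) _ _ _ _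
    (h ▸ Submodule.zero_mem _)
  have h2 : (0 : Fin n → ℤ) ≠ Pi.single i 1 + -Pi.single j 1 := by
    intro h0
    have := congrFun h0 i
    simp [hij] at this
  rw [isHomogeneous_one.vectorFunctional_eq_zero he h2, zero_smul,
    Fintype.sum_eq_single (i, j)] at h1
  · exact (smul_eq_zero.mp h1).resolve_left ((hy i j).vectorFunctional_ne_zero he)
  · rintro ⟨a, b⟩ hab
    rw [(hy a b).vectorFunctional_eq_zero he, zero_smul]
    intro h0
    refine hab ?_
    -- From `ε_a - ε_b = ε_i - ε_j` to an equality of sums: either the pairs agree, or `a = b` and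
    -- `i = j`, which is excluded.
    have h3 : (Pi.single a 1 + Pi.single j 1 : Fin n → ℤ) = Pi.single i 1 + Pi.single b 1 := by
      rw [← sub_eq_add_neg, ← sub_eq_add_neg, sub_eq_sub_iff_add_eq_add] at h0
      exact h0
    rw [Pi.single_add_single_eq_single_add_single one_ne_zero one_ne_zero] at h3
    rcases h3 with ⟨h3, h4⟩ | ⟨-, h3, h4⟩ | ⟨h3, -⟩
    · rw [h3, h4]
    · exact absurd h4.symm hij
    · norm_num at h3

end HilbertRep

/-! ## Coactions preserving the filtration -/

section TorusCoaction

variable {n : ℕ} {θ : Matrix (Fin n) (Fin n) ℝ}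

theorem torusGen_isHomogeneous {π : HilbertRep (NCTorus.{u} θ)} {e : (Fin n → ℤ) → π.H}
    (hx : ∀ i m, π.hom (torusGen θ i) (e m) = shiftPhase θ i m • e (m + Pi.single i 1))
    (i : Fin n) : π.IsHomogeneous e (torusGen θ i) (Pi.single i 1) :=
  fun m => ⟨_, shiftPhase_ne_zero θ i m, hx i m⟩

/-- Conjugating the commutation relation by `x_l` moves the adjoint to the right, where the words
spanning `V_{1,1}` have it. -/
theorem star_torusGen_mul_torusGen (k l : Fin n) :
    star (torusGen.{u} θ l) * torusGen θ k =
      torusPhase θ k l • (torusGen θ k * star (torusGen θ l)) := by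
  have hl := torusGen_mem_unitary.{u} θ l
  calc star (torusGen.{u} θ l) * torusGen θ k
      = star (torusGen θ l) * (torusGen θ k * torusGen θ l) * star (torusGen θ l) := by
        rw [mul_assoc, mul_assoc, Unitary.mul_star_self_of_mem hl, mul_one]
    _ = _ := by
        rw [torusGen_mul_torusGen, mul_smul_comm, smul_mul_assoc, ← mul_assoc,
          Unitary.star_mul_self_of_mem hl, one_mul]

theorem torusGen_mem_torusFiltration (k : Fin n) :
    torusGen.{u} θ k ∈ torusFiltration θ 1 0 :=
  Submodule.subset_span ⟨fun _ => k, Fin.elim0, fun _ l => l.elim0, by simp⟩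

theorem torusGen_mul_star_mem_torusFiltration {k l : Fin n} (h : k ≠ l) :
    torusGen.{u} θ k * star (torusGen θ l) ∈ torusFiltration θ 1 1 :=
  Submodule.subset_span ⟨fun _ => k, fun _ => l, fun _ _ => h, by simp⟩

/-- A word `x_i x_j^*` in `V_{1,1}` has `i ≠ j`, hence nonzero degree `ε_i - ε_j`. -/
theorem vectorFunctional_eq_zero_of_mem_torusFiltration {π : HilbertRep (NCTorus.{u} θ)}
    {e : (Fin n → ℤ) → π.H} (he : Orthonormal ℂ e)
    (hx : ∀ i, π.IsHomogeneous e (torusGen θ i) (Pi.single i 1)) :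
    ∀ v ∈ torusFiltration.{u} θ 1 1, π.vectorFunctional (e 0) (e 0) v = 0 := by
  intro v hv
  induction hv using Submodule.span_induction with
  | zero => exact map_zero _
  | add s t _ _ hs ht => rw [map_add, hs, ht, add_zero]
  | smul c t _ ht => rw [map_smul, ht, smul_zero]
  | mem w hw =>
    obtain ⟨i, j, hij, rfl⟩ := hw
    have h1 := (hx (i 0)).mul ((hx (j 0)).star (torusGen_mem_unitary θ _))
    have h2 := h1.vectorFunctional_eq_zero (m := 0) he (by
      rw [Ne, add_neg_eq_zero]
      intro h
      have := congrFun h (i 0)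
      simp [hij 0 0] at this)
    simpa using h2

variable {A : Type u} [CStarAlgebra A]

theorem exists_eq_sum_of_mem_algTensorSubspace {t : NCTorus.{u} θ ⊗ₘ A}
    (ht : t ∈ algTensorSubspace (torusFiltration.{u} θ 1 0) A) :
    ∃ a : Fin n → A, t = ∑ i, MinTensor.tmul (torusGen θ i) (a i) := by
  induction ht using Submodule.span_induction with
  | zero => exact ⟨0, by simp [MinTensor.tmul_zero]⟩
  | add s t _ _ hs ht =>
    obtain ⟨a, rfl⟩ := hs
    obtain ⟨b, rfl⟩ := ht
    exact ⟨a + b, by simp [MinTensor.tmul_add, Finset.sum_add_distrib]⟩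
  | smul c t _ ht =>
    obtain ⟨a, rfl⟩ := ht
    exact ⟨c • a, by simp [MinTensor.tmul_smul, Finset.smul_sum]⟩
  | mem t ht =>
    obtain ⟨v, hv, b, rfl⟩ := ht
    induction hv using Submodule.span_induction with
    | zero => exact ⟨0, by simp [MinTensor.tmul_zero, MinTensor.zero_tmul]⟩
    | add s t _ _ hs ht =>
      obtain ⟨a, ha⟩ := hs
      obtain ⟨a', ha'⟩ := ht
      exact ⟨a + a', by
        simp [MinTensor.tmul_add, MinTensor.add_tmul, Finset.sum_add_distrib, ha, ha']⟩
    | smul c t _ ht =>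
      obtain ⟨a, ha⟩ := ht
      exact ⟨c • a, by
        simp [MinTensor.tmul_smul, MinTensor.smul_tmul, Finset.smul_sum, ha]⟩
    | mem w hw =>
      obtain ⟨i, j, -, rfl⟩ := hw
      refine ⟨Pi.single (i 0) b, ?_⟩
      rw [Fintype.sum_eq_single (i 0)]
      · simp
      · intro k hk
        rw [Pi.single_eq_of_ne hk, MinTensor.tmul_zero]

theorem MinTensor.sum_tmul_mul_sum_tmul {B : Type u} [CStarAlgebra B] {ι : Type v} [Fintype ι]
    (b b' : ι → B) (a a' : ι → A) :
    (∑ i, tmul (b i) (a i)) * ∑ j, tmul (b' j) (a' j) =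
      ∑ i, ∑ j, tmul (b i * b' j) (a i * a' j) := by
  simp only [Finset.sum_mul_sum, tmul_mul_tmul]

theorem MinTensor.star_sum_tmul {B : Type u} [CStarAlgebra B] {ι : Type v} [Fintype ι]
    (b : ι → B) (a : ι → A) :
    star (∑ i, tmul (b i) (a i)) = ∑ i, tmul (star (b i)) (star (a i)) := by
  simp only [star_sum, star_tmul]

/-- Distinct generators have distinct degrees, so slicing in degree `ε_i` isolates the `i`-th
coefficient. This gives uniqueness of `u`. -/
theorem eq_of_sum_tmul_torusGen_eq {π : HilbertRep (NCTorus.{u} θ)}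
    {e : (Fin n → ℤ) → π.H} (he : Orthonormal ℂ e)
    (hx : ∀ i, π.IsHomogeneous e (torusGen θ i) (Pi.single i 1)) {a b : Fin n → A}
    (h : ∑ i, MinTensor.tmul (torusGen.{u} θ i) (a i) = ∑ i, MinTensor.tmul (torusGen θ i) (b i)) :
    a = b := by
  funext i
  have h1 := π.sum_vectorFunctional_smul_eq_zero (V := ⊥) (ζ := e 0) (ζ' := e (Pi.single i 1))
    (fun v hv => by rw [(Submodule.mem_bot ℂ).mp hv, map_zero]) Finset.univ
    (torusGen θ) (a - b) (by
      simp only [Pi.sub_apply, MinTensor.tmul_sub, Finset.sum_sub_distrib]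
      rw [h, sub_self]
      exact Submodule.zero_mem _)
  rw [Fintype.sum_eq_single i] at h1
  · exact sub_eq_zero.mp
      ((smul_eq_zero.mp h1).resolve_left ((hx i).vectorFunctional_ne_zero he))
  · intro j hj
    rw [(hx j).vectorFunctional_eq_zero he, zero_smul]
    intro h0
    have := congrFun h0 j
    simp [hj] at this

/-- Comparison of the coefficients of products of two generators. -/
theorem add_torusPhase_smul_eq_zero {π : HilbertRep (NCTorus.{u} θ)}
    {e : (Fin n → ℤ) → π.H} (he : Orthonormal ℂ e)
    (hx : ∀ i, π.IsHomogeneous e (torusGen θ i) (Pi.single i 1)) {c : Fin n → Fin n → A}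
    (h : ∑ i, ∑ j, MinTensor.tmul (torusGen.{u} θ i * torusGen θ j) (c i j) = 0)
    (i j : Fin n) : c i j + torusPhase θ j i • c j i = 0 := by
  rw [← Fintype.sum_prod_type'] at h
  let τ := π.vectorFunctional (e 0) (e (Pi.single i 1 + Pi.single j 1))
  have h1 : ∑ p : Fin n × Fin n, τ (torusGen θ p.1 * torusGen θ p.2) • c p.1 p.2 = 0 :=
    π.sum_vectorFunctional_smul_eq_zero (V := ⊥)
      (fun v hv => by rw [(Submodule.mem_bot ℂ).mp hv, map_zero]) _ _ _
      (h ▸ Submodule.zero_mem _)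
  have h2 : τ (torusGen θ i * torusGen θ j) ≠ 0 :=
    ((hx i).mul (hx j)).vectorFunctional_ne_zero he
  have h3 : ∀ p : Fin n × Fin n, p ≠ (i, j) → p ≠ (j, i) →
      τ (torusGen θ p.1 * torusGen θ p.2) • c p.1 p.2 = 0 := by
    rintro ⟨a, b⟩ hp hp'
    rw [((hx a).mul (hx b)).vectorFunctional_eq_zero he, zero_smul]
    intro h0
    rw [Pi.single_add_single_eq_single_add_single one_ne_zero one_ne_zero] at h0
    rcases h0 with ⟨h3, h4⟩ | ⟨-, h3, h4⟩ | ⟨h3, -⟩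
    · exact hp (by rw [h3, h4])
    · exact hp' (by rw [h3, h4])
    · norm_num at h3
  -- For `i = j` only one product has this degree, and already `c i i = 0`.
  by_cases hij : i = j
  · subst hij
    rw [Fintype.sum_eq_single (i, i) fun p hp => h3 p hp hp] at h1
    rw [(smul_eq_zero.mp h1).resolve_left h2, smul_zero, add_zero]
  · rw [Fintype.sum_eq_add (i, j) (j, i) (fun hp => hij (congrArg Prod.fst hp))
      fun p hp => h3 p hp.1 hp.2] at h1
    -- Rewriting `x_j x_i = ω_ji x_i x_j` leaves a common nonzero factor `τ(x_i x_j)`.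
    rw [torusGen_mul_torusGen θ j i, map_smul, smul_eq_mul, mul_comm, ← smul_smul, ← smul_add] at h1
    exact (smul_eq_zero.mp h1).resolve_left h2

end TorusCoaction

/-! ### The relations for the coefficients. -/

theorem mainTheorem10 {n : ℕ} (θ : Matrix (Fin n) (Fin n) ℝ) (hθ : θ.transpose = -θ)
    {A : Type u} [CStarAlgebra A] (G : CompactQuantumGroup A)
    (α : Coaction G (NCTorus.{u} θ))
    (hα : α.Preserves (fun r : ℕ × ℕ => torusFiltration.{u} θ r.1 r.2)) :
    (∃! u : Fin n → Fin n → A,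
      ∀ k, α.hom (torusGen θ k) = ∑ i, MinTensor.tmul (torusGen θ i) (u i k)) ∧
    ∀ u : Fin n → Fin n → A,
      (∀ k, α.hom (torusGen θ k) = ∑ i, MinTensor.tmul (torusGen θ i) (u i k)) →
        (∀ i j k l, u i k * u j l + torusPhase θ j i • (u j k * u i l) =
          torusPhase θ k l • (u i l * u j k) +
            (torusPhase θ j i * torusPhase θ k l) • (u j l * u i k)) ∧
        (∀ k l, ∑ i, u i k * star (u i l) = if k = l then 1 else 0) ∧
        (∀ k l, ∑ i, star (u i l) * u i k = if k = l then 1 else 0) ∧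
        (∀ i j k, i ≠ j → u j k * star (u i k) = 0) ∧
        (∀ i j k, i ≠ j → star (u i k) * u j k = 0) := by
  obtain ⟨π, e, he, hx'⟩ := exists_hilbertRep_shift.{u} hθ
  have hx := torusGen_isHomogeneous hx'
  have hu := torusGen_mem_unitary.{u} θ
  have h11 := vectorFunctional_eq_zero_of_mem_torusFiltration he hx
  have hy : ∀ i j, π.IsHomogeneous e (torusGen θ i * star (torusGen θ j))
      (Pi.single i 1 + -Pi.single j 1) := fun i j => (hx i).mul ((hx j).star (hu j))
  have hy' : ∀ i j, π.IsHomogeneous e (star (torusGen θ j) * torusGen θ i)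
      (Pi.single i 1 + -Pi.single j 1) := fun i j => by
    rw [add_comm]; exact ((hx j).star (hu j)).mul (hx i)
  constructor
  · choose u hu using fun k => exists_eq_sum_of_mem_algTensorSubspace
      (hα (1, 0) _ (torusGen_mem_torusFiltration k))
    refine ⟨fun i k => u k i, hu, fun w hw => ?_⟩
    funext i k
    exact congrFun (eq_of_sum_tmul_torusGen_eq he hx ((hw k).symm.trans (hu k))) i
  intro u h
  have hmul : ∀ k l, α.hom (torusGen θ k * torusGen θ l) =
      ∑ i, ∑ j, MinTensor.tmul (torusGen θ i * torusGen θ j) (u i k * u j l) := fun k l => by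
    rw [map_mul, h, h, MinTensor.sum_tmul_mul_sum_tmul]
  have hstar : ∀ k l, α.hom (torusGen θ k * star (torusGen θ l)) =
      ∑ i, ∑ j, MinTensor.tmul (torusGen θ i * star (torusGen θ j)) (u i k * star (u j l)) :=
    fun k l => by
      rw [map_mul, map_star, h, h, MinTensor.star_sum_tmul, MinTensor.sum_tmul_mul_sum_tmul]
  have hstar' : ∀ k l, α.hom (star (torusGen θ l) * torusGen θ k) =
      ∑ i, ∑ j, MinTensor.tmul (star (torusGen θ j) * torusGen θ i) (star (u j l) * u i k) :=
    fun k l => by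
      rw [map_mul, map_star, h, h, MinTensor.star_sum_tmul, MinTensor.sum_tmul_mul_sum_tmul,
        Finset.sum_comm]
  have hself : ∀ k, ∑ i, ∑ j, MinTensor.tmul (torusGen θ i * star (torusGen θ j))
      (u i k * star (u j k)) = MinTensor.tmul 1 1 := fun k => by
    rw [← hstar, Unitary.mul_star_self_of_mem (hu k), map_one, MinTensor.one_def]
  have hself' : ∀ k, ∑ i, ∑ j, MinTensor.tmul (star (torusGen θ j) * torusGen θ i)
      (star (u j k) * u i k) = MinTensor.tmul 1 1 := fun k => by
    rw [← hstar', Unitary.star_mul_self_of_mem (hu k), map_one, MinTensor.one_def]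
  refine ⟨fun i j k l => ?_, fun k l => ?_, fun k l => ?_, fun i j k hij => ?_,
    fun i j k hij => ?_⟩
  -- This is `α(x_k x_l - ω_kl x_l x_k) = 0`, expanded.
  · have h1 : ∑ i, ∑ j, MinTensor.tmul (torusGen θ i * torusGen θ j)
        (u i k * u j l - torusPhase θ k l • (u i l * u j k)) = 0 := by
      simp only [MinTensor.tmul_sub, MinTensor.tmul_smul, Finset.sum_sub_distrib,
        ← Finset.smul_sum]
      rw [← hmul, ← hmul, ← map_smul, ← torusGen_mul_torusGen, sub_self]
    have h2 := add_torusPhase_smul_eq_zero he hx h1 i j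
    rw [smul_sub, smul_smul] at h2
    rw [← sub_eq_zero, ← h2]
    abel
  · refine HilbertRep.sum_diagonal_eq (c := fun i j => u i k * star (u j l)) he hy
      (fun i => Unitary.mul_star_self_of_mem (hu i)) h11 ?_
    -- For `k = l` the difference is exactly 0, since `α(1) = 1`; for `k ≠ l` it lies in `V_{1,1} ⊗
    -- A`.
    split_ifs with hkl
    · subst hkl
      rw [hself, sub_self]
      exact Submodule.zero_mem _
    · rw [← hstar, MinTensor.tmul_zero, sub_zero]
      exact hα (1, 1) _ (torusGen_mul_star_mem_torusFiltration hkl)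
  · refine HilbertRep.sum_diagonal_eq (c := fun i j => star (u j l) * u i k) he hy'
      (fun i => Unitary.star_mul_self_of_mem (hu i)) h11 ?_
    split_ifs with hkl
    · subst hkl
      rw [hself', sub_self]
      exact Submodule.zero_mem _
    · rw [← hstar', MinTensor.tmul_zero, sub_zero, star_torusGen_mul_torusGen]
      exact hα (1, 1) _ (Submodule.smul_mem _ _ (torusGen_mul_star_mem_torusFiltration hkl))
  · exact HilbertRep.eq_zero_of_sum_eq (c := fun i j => u i k * star (u j k)) he hy (hself k)
      hij.symm
  · exact HilbertRep.eq_zero_of_sum_eq (c := fun i j => star (u j k) * u i k) he hy' (hself' k)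
      hij.symm
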